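/- For $x\in\mathbb{R}$ write $[\ln\ln]_+(x)=\ln\ln\max\{x,e^e\}$, where $\ln$ is the natural logarithm. There is an absolute constant $D_1>0$ such that the following holds. Let $X_1,X_2,\dots$ be i.i.d. real random variables on a probability space with $X_1\in[-2,2]$ almost surely and $\mathbb{E}X_1=0$, and let $$V_n=\frac{n}{n-1}\left(\sum_{i=1}^n X_i^2-\frac1n\Big(\sum_{i=1}^n X_i\Big)^2\right)\quad(n\ge 2),\qquad V_1=0.$$ Then for every $0<\delta<1$, with probability at least $1-\delta$, for all integers $n\ge\ln\frac1\delta$ simultaneously, $$\left|\sum_{i=1}^n X_i\right|\le D_1\left(1+\ln\tfrac1\delta+\sqrt{\left(1+\ln\tfrac1\delta+V_n\right)\left([\ln\ln]_+\left(1+\ln\tfrac1\delta+V_n\right)+\ln\tfrac1\delta\right)}\right).$$ -/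

import Mathlib

open MeasureTheory ProbabilityTheory

/-- The truncated iterated logarithm `[ln ln]₊ (x) = ln ln max {x, e ^ e}`. -/
noncomputable def lnLnPlus (x : ℝ) : ℝ :=
  Real.log (Real.log (max x (Real.exp (Real.exp 1))))

/-- The (unnormalised) empirical variance of the first `n` terms of a real sequence,
`V_n = n / (n - 1) * (∑ x_i ^ 2 - (1 / n) * (∑ x_i) ^ 2)`, the terms being `x 0, …, x (n - 1)`.
For `n = 1` the bracket is `0` and the value is `0`. -/
noncomputable def empVariance (x : ℕ → ℝ) (n : ℕ) : ℝ :=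
  (n : ℝ) / ((n : ℝ) - 1) *
    (∑ i ∈ Finset.range n, x i ^ 2 - 1 / (n : ℝ) * (∑ i ∈ Finset.range n, x i) ^ 2)

open Filter Finset
open scoped NNReal ENNReal Topology

/-! Write S for the sum, Q for the sum of squares, L = log(1/δ). For |l| ≤ 1/4 the products ∏ (1 + l
X_i) form a nonnegative martingale of mean one dominating exp(l S - 2 l² Q), so Ville's inequality
bounds l S - 2 l² Q for all n at once (`measure_exists_le_mul_sum_sub_le`). A union bound over the
slopes ±2^(-j)/8 costs log(2(j+1)(j+2)) in the threshold.

The rest is deterministic. Since |S| ≤ 2n, Q ≤ V + S²/n ≤ V + 2|S|, and the slopes are small enough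
to absorb the |S| term (`abs_sum_le_of_forall_slope`). Choosing the best j gives the square root,
and the cost of that j is O(ln ln) (`le_of_forall_dyadic_le`). -/

/-- **Ville's inequality** for the product of independent nonnegative bounded random variables
of mean one. -/
theorem measure_exists_le_prod_le_inv {Ω : Type*} [MeasurableSpace Ω] {μ : Measure Ω}
    [IsProbabilityMeasure μ] {Y : ℕ → Ω → ℝ} (hY : iIndepFun Y μ)
    (hm : ∀ i, Measurable (Y i)) (h0 : ∀ i ω, 0 ≤ Y i ω) {B : ℝ} (hB : ∀ i ω, Y i ω ≤ B)
    (h1 : ∀ i, ∫ ω, Y i ω ∂μ = 1) {c : ℝ} (hc : 0 < c) :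
    μ {ω | ∃ n, c ≤ ∏ i ∈ range (n + 1), Y i ω} ≤ ENNReal.ofReal c⁻¹ := by
  have hsm : ∀ i, StronglyMeasurable (Y i) := fun i => (hm i).stronglyMeasurable
  set F := Filtration.natural Y hsm with hF
  set M : ℕ → Ω → ℝ := fun n ω => ∏ i ∈ range (n + 1), Y i ω with hM
  have hadp : StronglyAdapted F M := by
    intro n
    refine Finset.stronglyMeasurable_fun_prod _ fun i hi => ?_
    exact (Filtration.stronglyAdapted_natural hsm i).mono
      (F.mono (Nat.lt_succ_iff.1 (Finset.mem_range.1 hi)))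
  have hYint : ∀ i, Integrable (Y i) μ := fun i =>
    Integrable.of_bound (hm i).aestronglyMeasurable B
      (ae_of_all _ fun ω => by rw [Real.norm_of_nonneg (h0 i ω)]; exact hB i ω)
  have hMpos : ∀ n ω, 0 ≤ M n ω := fun n ω => Finset.prod_nonneg fun i _ => h0 i ω
  have hMle : ∀ n ω, M n ω ≤ B ^ (n + 1) := fun n ω => by
    have := Finset.prod_le_prod (s := range (n + 1)) (fun i _ => h0 i ω) (fun i _ => hB i ω)
    simpa using this
  have hMint : ∀ n, Integrable (M n) μ := fun n =>
    Integrable.of_bound ((hadp n).mono (F.le n)).aestronglyMeasurable (B ^ (n + 1))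
      (ae_of_all _ fun ω => by rw [Real.norm_of_nonneg (hMpos n ω)]; exact hMle n ω)
  have hsucc : ∀ n, M (n + 1) = M n * Y (n + 1) := fun n => by
    ext ω
    simp only [hM, Pi.mul_apply]
    rw [Finset.prod_range_succ]
  have hmart : Martingale M F μ := by
    refine martingale_nat hadp hMint fun n => ?_
    have hpull := condExp_mul_of_stronglyMeasurable_left (μ := μ) (m := F n) (hadp n)
      (by rw [← hsucc]; exact hMint (n + 1)) (hYint (n + 1))
    have hind := hY.condExp_natural_ae_eq_of_lt hsm (Nat.lt_succ_self n)
    rw [hsucc]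
    filter_upwards [hpull, hind] with ω h2 h3
    rw [h2, Pi.mul_apply, h3, h1, mul_one]
  have hMone : ∀ n, ∫ ω, M n ω ∂μ = 1 := fun n => by
    have h := hmart.setIntegral_eq (Nat.zero_le n) (MeasurableSet.univ)
    rw [setIntegral_univ, setIntegral_univ] at h
    rw [← h]
    simpa [hM] using h1 0
  set A : ℕ → Set Ω := fun n =>
    {ω | c ≤ (range (n + 1)).sup' nonempty_range_add_one fun k => M k ω} with hA
  have hAmem : ∀ n ω, ω ∈ A n ↔ ∃ k ≤ n, c ≤ M k ω := fun n ω => by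
    simp [hA, Finset.le_sup'_iff]
  have hAle : ∀ n, μ (A n) ≤ ENNReal.ofReal c⁻¹ := fun n => by
    have h := maximal_ineq hmart.submartingale (fun k ω => hMpos k ω) (ε := c.toNNReal) n
    rw [Real.coe_toNNReal c hc.le] at h
    have h2 : ENNReal.ofReal (∫ ω in A n, M n ω ∂μ) ≤ 1 := by
      rw [← ENNReal.ofReal_one]
      refine ENNReal.ofReal_le_ofReal ?_
      rw [← hMone n]
      exact setIntegral_le_integral (hMint n) (ae_of_all _ (hMpos n))
    rw [ENNReal.ofReal_inv_of_pos hc, ENNReal.le_inv_iff_mul_le, mul_comm]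
    exact h.trans h2
  have hmono : Monotone A := fun m n hmn ω hω => by
    obtain ⟨k, hk, h⟩ := (hAmem m ω).1 hω
    exact (hAmem n ω).2 ⟨k, hk.trans hmn, h⟩
  have hU : {ω | ∃ n, c ≤ ∏ i ∈ range (n + 1), Y i ω} = ⋃ n, A n := by
    ext ω
    simp only [Set.mem_iUnion, hAmem, Set.mem_ofPred_eq]
    exact ⟨fun ⟨n, h⟩ => ⟨n, n, le_rfl, h⟩, fun ⟨_, k, _, h⟩ => ⟨k, h⟩⟩
  rw [hU, hmono.measure_iUnion]
  exact iSup_le hAle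

/-- From log(1 + y) ≥ y/(1 + y); the remaining gap y²(1 + 2y)/(1 + y) is nonnegative because y ≥
-1/2. -/
theorem exp_sub_two_mul_sq_le_one_add {y : ℝ} (hy : -(1 / 2) ≤ y) :
    Real.exp (y - 2 * y ^ 2) ≤ 1 + y := by
  have hpos : 0 < 1 + y := by linarith
  rw [← Real.le_log_iff_exp_le hpos]
  refine le_trans ?_ (Real.one_sub_inv_le_log_of_pos hpos)
  have h : 1 - (1 + y)⁻¹ - (y - 2 * y ^ 2) = y ^ 2 * (1 + 2 * y) / (1 + y) := by
    field_simp
    ring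
  have : 0 ≤ y ^ 2 * (1 + 2 * y) / (1 + y) :=
    div_nonneg (mul_nonneg (sq_nonneg y) (by linarith)) hpos.le
  linarith

/-- A self-normalised maximal inequality for centred independent variables bounded by two. -/
theorem measure_exists_le_mul_sum_sub_le {Ω : Type*} [MeasurableSpace Ω] {μ : Measure Ω}
    [IsProbabilityMeasure μ] {X : ℕ → Ω → ℝ} (hX : iIndepFun X μ)
    (hm : ∀ i, AEMeasurable (X i) μ) (hb : ∀ i, ∀ᵐ ω ∂μ, X i ω ∈ Set.Icc (-2 : ℝ) 2)
    (h0 : ∀ i, ∫ ω, X i ω ∂μ = 0) {l : ℝ} (hl : |l| ≤ 1 / 4) (a : ℝ) :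
    μ {ω | ∃ n, a ≤ l * ∑ i ∈ range (n + 1), X i ω -
        2 * l ^ 2 * ∑ i ∈ range (n + 1), X i ω ^ 2} ≤ ENNReal.ofReal (Real.exp (-a)) := by
  obtain ⟨hl1, hl2⟩ := abs_le.1 hl
  -- A measurable, clipped version of X: Ville's inequality above needs the bounds at every ω.
  set Z : ℕ → Ω → ℝ := fun i ω => max (-2) (min 2 ((hm i).mk (X i) ω)) with hZ
  have hZm : ∀ i, Measurable (Z i) := fun i =>
    measurable_const.max (measurable_const.min (hm i).measurable_mk)
  have hZX : ∀ i, X i =ᵐ[μ] Z i := fun i => by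
    filter_upwards [hb i, (hm i).ae_eq_mk] with ω hω h
    rw [hZ]
    dsimp only
    rw [← h, min_eq_right hω.2, max_eq_right hω.1]
  have hZlo : ∀ i ω, -2 ≤ Z i ω := fun i ω => le_max_left _ _
  have hZhi : ∀ i ω, Z i ω ≤ 2 := fun i ω => max_le (by norm_num) (min_le_left _ _)
  have hlZ : ∀ i ω, |l * Z i ω| ≤ 1 / 2 := fun i ω => by
    rw [abs_mul]
    have : |Z i ω| ≤ 2 := abs_le.2 ⟨hZlo i ω, hZhi i ω⟩
    calc |l| * |Z i ω| ≤ 1 / 4 * 2 := by gcongr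
      _ = 1 / 2 := by norm_num
  have hZint : ∀ i, Integrable (Z i) μ := fun i =>
    Integrable.of_bound (hZm i).aestronglyMeasurable 2
      (ae_of_all _ fun ω => abs_le.2 ⟨hZlo i ω, hZhi i ω⟩)
  have hind : iIndepFun (fun i ω => 1 + l * Z i ω) μ :=
    (hX.congr hZX).comp (fun _ z => 1 + l * z) fun _ => by fun_prop
  have hville := measure_exists_le_prod_le_inv (c := Real.exp a) (B := 3 / 2) hind
    (fun i => by have := hZm i; fun_prop)
    (fun i ω => by linarith [(abs_le.1 (hlZ i ω)).1])
    (fun i ω => by linarith [(abs_le.1 (hlZ i ω)).2])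
    (fun i => by
      rw [integral_add (integrable_const _) ((hZint i).const_mul l), integral_const_mul,
        ← integral_congr_ae (hZX i), h0]
      simp)
    (Real.exp_pos a)
  rw [Real.exp_neg]
  refine le_trans (measure_mono_ae ?_) hville
  filter_upwards [ae_all_iff.2 hZX] with ω hω
  rintro ⟨n, hn⟩
  refine ⟨n, ?_⟩
  simp only [hω] at hn
  calc Real.exp a ≤ Real.exp (∑ i ∈ range (n + 1), (l * Z i ω - 2 * (l * Z i ω) ^ 2)) := by
        refine Real.exp_le_exp.2 (hn.trans_eq ?_)
        rw [Finset.sum_sub_distrib, Finset.mul_sum, Finset.mul_sum]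
        congr 1
        exact Finset.sum_congr rfl fun i _ => by ring
    _ = ∏ i ∈ range (n + 1), Real.exp (l * Z i ω - 2 * (l * Z i ω) ^ 2) := Real.exp_sum _ _
    _ ≤ ∏ i ∈ range (n + 1), (1 + l * Z i ω) :=
        Finset.prod_le_prod (fun _ _ => (Real.exp_pos _).le) fun i _ =>
          exp_sub_two_mul_sq_le_one_add (by linarith [(abs_le.1 (hlZ i ω)).1])

theorem hasSum_one_div_succ_mul_succ_succ :
    HasSum (fun j : ℕ => 1 / (((j : ℝ) + 1) * (j + 2))) 1 := by
  rw [hasSum_iff_tendsto_nat_of_nonneg (fun j => by positivity)]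
  have h : ∀ n : ℕ, ∑ j ∈ range n, 1 / (((j : ℝ) + 1) * (j + 2)) = 1 - 1 / ((n : ℝ) + 1) := by
    intro n
    induction n with
    | zero => simp
    | succ n ih =>
      rw [Finset.sum_range_succ, ih]
      push_cast
      field_simp
      ring
  simp only [h]
  simpa using tendsto_one_div_add_atTop_nhds_zero_nat.const_sub (1 : ℝ)

theorem one_le_lnLnPlus (R : ℝ) : 1 ≤ lnLnPlus R := by
  have h1 : Real.exp 1 ≤ Real.log (max R (Real.exp (Real.exp 1))) := by
    rw [Real.le_log_iff_exp_le (lt_max_of_lt_right (Real.exp_pos _))]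
    exact le_max_right _ _
  rw [lnLnPlus, Real.le_log_iff_exp_le ((Real.exp_pos 1).trans_le h1)]
  exact h1

/-- With T the truncated log of R, 4^j ≤ R forces j ≤ T, so the quadratic weight is at most 8T² ≤
T^5. -/
theorem log_weight_le_five_mul_lnLnPlus {R : ℝ} {j : ℕ}
    (hj : ((2 : ℝ) ^ j) ^ 2 ≤ R) :
    Real.log (2 * ((j + 1) * (j + 2))) ≤ 5 * lnLnPlus R := by
  set T := Real.log (max R (Real.exp (Real.exp 1))) with hT
  have he : (2 : ℝ) ≤ Real.exp 1 := by linarith [Real.add_one_le_exp 1]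
  have hTe : Real.exp 1 ≤ T := by
    rw [hT, Real.le_log_iff_exp_le (lt_max_of_lt_right (Real.exp_pos _))]
    exact le_max_right _ _
  have hT2 : 2 ≤ T := he.trans hTe
  have hjT : (j : ℝ) ≤ T := by
    have h1 : Real.log (((2 : ℝ) ^ j) ^ 2) ≤ T :=
      Real.log_le_log (by positivity) (hj.trans (le_max_left _ _))
    rw [Real.log_pow, Real.log_pow] at h1
    push_cast at h1
    nlinarith [Real.log_two_gt_d9, (Nat.cast_nonneg j : (0 : ℝ) ≤ j)]
  have hle : (2 : ℝ) * ((j + 1) * (j + 2)) ≤ T ^ 5 := by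
    have hj0 : (0 : ℝ) ≤ j := Nat.cast_nonneg j
    calc (2 : ℝ) * ((j + 1) * (j + 2)) ≤ 2 * ((T + T) * (T + T)) := by
          gcongr; linarith
      _ = 2 ^ 3 * T ^ 2 := by ring
      _ ≤ T ^ 3 * T ^ 2 := by gcongr
      _ = T ^ 5 := by ring
  calc Real.log (2 * ((j + 1) * (j + 2))) ≤ Real.log (T ^ 5) :=
        Real.log_le_log (by positivity) hle
    _ = 5 * lnLnPlus R := by rw [Real.log_pow, lnLnPlus, ← hT]; norm_num

/-- Optimising a family of linear bounds over a dyadic grid of slopes. -/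
theorem le_of_forall_dyadic_le {s V L : ℝ} (hV : 0 ≤ V) (hL : 0 ≤ L)
    (h : ∀ j : ℕ, s ≤ (1 / (2 * 2 ^ j)) * V +
      16 * 2 ^ j * (L + Real.log (2 * (((j : ℝ) + 1) * (j + 2))))) :
    s ≤ 100 * (1 + L + Real.sqrt ((1 + L + V) * (lnLnPlus (1 + L + V) + L))) := by
  set R := 1 + L + V with hRdef
  have hR : 1 ≤ R := by linarith
  have hl := one_le_lnLnPlus R
  set K := lnLnPlus R + L with hK
  have hK1 : 1 ≤ K := by linarith
  have hw : 0 ≤ Real.sqrt (R * K) := Real.sqrt_nonneg _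
  have hww : Real.sqrt (R * K) ^ 2 = R * K := Real.sq_sqrt (by positivity)
  set w := Real.sqrt (R * K)
  -- If R ≤ K, the largest slope j = 0 suffices, as V ≤ R ≤ w.
  rcases le_or_gt R K with hRK | hKR
  · have hRw : R ≤ w := by
      apply Real.le_sqrt_of_sq_le
      nlinarith
    have h0 : s ≤ 1 / 2 * V + 16 * (L + Real.log 4) := by
      refine (h 0).trans_eq ?_
      norm_num
    have hlog := Real.log_le_sub_one_of_pos (x := 4) (by norm_num)
    linarith
  -- y = √(R/K) balances R/y against yK; 2^j is y rounded down to a power of two.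
  · set y := w / K with hy
    have hyK : y * K = w := by rw [hy]; field_simp
    have hKw : K ≤ w := by
      apply Real.le_sqrt_of_sq_le
      nlinarith
    have hy1 : 1 ≤ y := by rw [hy, one_le_div (by linarith)]; exact hKw
    have hyw : y * w = R := by
      rw [hy, div_mul_eq_mul_div, ← sq, hww]; field_simp
    obtain ⟨j, hj1, hj2⟩ := exists_nat_pow_near hy1 (one_lt_two : (1 : ℝ) < 2)
    have hp : (0 : ℝ) < 2 ^ j := by positivity
    have hjR : ((2 : ℝ) ^ j) ^ 2 ≤ R := by
      calc ((2 : ℝ) ^ j) ^ 2 ≤ y ^ 2 := by gcongr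
        _ = y * y := sq y
        _ ≤ y * w := by
          gcongr
          rw [← hyK]; nlinarith
        _ = R := hyw
    have hlog := log_weight_le_five_mul_lnLnPlus hjR
    have h1 : (1 / (2 * 2 ^ j)) * V ≤ w := by
      rw [div_mul_eq_mul_div, one_mul, div_le_iff₀ (by positivity)]
      rw [pow_succ] at hj2
      nlinarith
    have h2 : 16 * 2 ^ j * (L + Real.log (2 * (((j : ℝ) + 1) * (j + 2)))) ≤ 80 * w := by
      calc 16 * 2 ^ j * (L + Real.log (2 * (((j : ℝ) + 1) * (j + 2))))
          ≤ 16 * 2 ^ j * (5 * K) := by gcongr; linarith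
        _ ≤ 16 * y * (5 * K) := by gcongr
        _ = 80 * w := by rw [← hyK]; ring
    have := h j
    linarith

theorem empVariance_nonneg (x : ℕ → ℝ) (n : ℕ) : 0 ≤ empVariance x (n + 1) := by
  have hn : (0 : ℝ) < n + 1 := by positivity
  have hcs := sq_sum_le_card_mul_sum_sq (s := range (n + 1)) (f := x)
  rw [card_range] at hcs
  push_cast at hcs
  rw [empVariance]
  push_cast
  refine mul_nonneg (div_nonneg hn.le (by simp)) ?_
  rw [sub_nonneg, div_mul_eq_mul_div, one_mul, div_le_iff₀ hn]
  linarith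

theorem sum_sq_le_empVariance_add (x : ℕ → ℝ) (n : ℕ) :
    ∑ i ∈ range (n + 1), x i ^ 2 ≤
      empVariance x (n + 1) + (∑ i ∈ range (n + 1), x i) ^ 2 / (n + 1) := by
  -- For a single term the variance is 0 by division by zero, and equality holds.
  rcases Nat.eq_zero_or_pos n with rfl | hn
  · simp [empVariance]
  have hn' : (0 : ℝ) < n := by exact_mod_cast hn
  have hcs := sq_sum_le_card_mul_sum_sq (s := range (n + 1)) (f := x)
  rw [card_range] at hcs
  push_cast at hcs
  rw [empVariance]
  push_cast
  set Q := ∑ i ∈ range (n + 1), x i ^ 2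
  set S := ∑ i ∈ range (n + 1), x i
  have h1 : 0 ≤ Q - 1 / ((n : ℝ) + 1) * S ^ 2 := by
    rw [sub_nonneg, div_mul_eq_mul_div, one_mul, div_le_iff₀ (by positivity)]
    linarith
  have h2 : 1 ≤ ((n : ℝ) + 1) / (n + 1 - 1) := by
    rw [add_sub_cancel_right, one_le_div hn']; linarith
  have h3 := le_mul_of_one_le_left h1 h2
  have h4 : 1 / ((n : ℝ) + 1) * S ^ 2 = S ^ 2 / (n + 1) := by ring
  linarith

/-- The deterministic part: the self-normalised linear bounds with slopes `± 2 ^ (-j) / 8` imply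
the iterated logarithm bound in terms of the empirical variance. -/
theorem abs_sum_le_of_forall_slope {x : ℕ → ℝ} (hx : ∀ i, |x i| ≤ 2) {L : ℝ} (hL : 0 ≤ L) (n : ℕ)
    (h : ∀ j : ℕ, 1 / (8 * 2 ^ j) * |∑ i ∈ range (n + 1), x i| -
        2 * (1 / (8 * 2 ^ j)) ^ 2 * ∑ i ∈ range (n + 1), x i ^ 2 ≤
      L + Real.log (2 * (((j : ℝ) + 1) * (j + 2)))) :
    |∑ i ∈ range (n + 1), x i| ≤ 100 * (1 + L +
      Real.sqrt ((1 + L + empVariance x (n + 1)) *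
        (lnLnPlus (1 + L + empVariance x (n + 1)) + L))) := by
  refine le_of_forall_dyadic_le (empVariance_nonneg x n) hL fun j => ?_
  have hQ := sum_sq_le_empVariance_add x n
  have hS : |∑ i ∈ range (n + 1), x i| ≤ 2 * (n + 1) := by
    refine (abs_sum_le_sum_abs _ _).trans ((sum_le_sum fun i _ => hx i).trans_eq ?_)
    simp [mul_comm]
  have hj := h j
  set Q := ∑ i ∈ range (n + 1), x i ^ 2
  rw [← sq_abs (∑ i ∈ range (n + 1), x i)] at hQ
  set S := |∑ i ∈ range (n + 1), x i| with hSdef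
  have hS0 : 0 ≤ S := abs_nonneg _
  set V := empVariance x (n + 1)
  set a := L + Real.log (2 * (((j : ℝ) + 1) * (j + 2)))
  set p : ℝ := 2 ^ j with hp
  have hp1 : 1 ≤ p := one_le_pow₀ one_le_two
  have hSn : S ^ 2 / (n + 1) ≤ 2 * S := by
    rw [div_le_iff₀ (by positivity)]; nlinarith
  have hQ2 : Q ≤ V + 2 * S := hQ.trans (by linarith)
  have e : 1 / (8 * p) * S - 2 * (1 / (8 * p)) ^ 2 * Q = (S - Q / (4 * p)) / (8 * p) := by
    field_simp
    ring
  rw [e, div_le_iff₀ (by positivity)] at hj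
  -- The term S/2 is absorbed on the left, which doubles the remaining terms.
  have h1 : Q / (4 * p) ≤ V / (4 * p) + S / 2 := by
    have h2 : S / (2 * p) ≤ S / 2 := by
      apply div_le_div_of_nonneg_left hS0 (by norm_num); linarith
    have h3 : Q / (4 * p) ≤ (V + 2 * S) / (4 * p) := by gcongr
    have h4 : (V + 2 * S) / (4 * p) = V / (4 * p) + S / (2 * p) := by
      field_simp; ring
    linarith
  have e2 : 1 / (2 * p) * V = 2 * (V / (4 * p)) := by field_simp; ring
  rw [e2]
  linarith

theorem mainTheorem10 :
    ∃ D₁ : ℝ, 0 < D₁ ∧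
      ∀ (Ω : Type*) [MeasurableSpace Ω] (μ : Measure Ω) [IsProbabilityMeasure μ]
        (X : ℕ → Ω → ℝ),
        iIndepFun X μ →
        (∀ i, IdentDistrib (X i) (X 0) μ μ) →
        (∀ᵐ ω ∂μ, X 0 ω ∈ Set.Icc (-2 : ℝ) 2) →
        (∫ ω, X 0 ω ∂μ = 0) →
        ∀ δ : ℝ, 0 < δ → δ < 1 →
          1 - δ ≤ μ.real {ω | ∀ n : ℕ, Real.log (1 / δ) ≤ (n : ℝ) →
            |∑ i ∈ Finset.range n, X i ω| ≤
              D₁ * (1 + Real.log (1 / δ) +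
                Real.sqrt ((1 + Real.log (1 / δ) + empVariance (fun i => X i ω) n) *
                  (lnLnPlus (1 + Real.log (1 / δ) + empVariance (fun i => X i ω) n) +
                    Real.log (1 / δ))))} := by
  refine ⟨100, by norm_num, ?_⟩
  intro Ω _ μ _ X hX hid hb h0 δ hδ hδ1
  have hm : ∀ i, AEMeasurable (X i) μ := fun i => (hid i).aemeasurable_fst
  have hbi : ∀ i, ∀ᵐ ω ∂μ, X i ω ∈ Set.Icc (-2 : ℝ) 2 := fun i =>
    (hid i).symm.ae_mem_snd measurableSet_Icc hb
  have h0i : ∀ i, ∫ ω, X i ω ∂μ = 0 := fun i => (hid i).integral_eq.trans h0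
  have hL : 0 < Real.log (1 / δ) := Real.log_pos ((one_lt_div hδ).2 hδ1)
  set L := Real.log (1 / δ) with hLdef
  set G : Set Ω := {ω | ∀ n : ℕ, L ≤ (n : ℝ) →
            |∑ i ∈ Finset.range n, X i ω| ≤
              100 * (1 + L +
                Real.sqrt ((1 + L + empVariance (fun i => X i ω) n) *
                  (lnLnPlus (1 + L + empVariance (fun i => X i ω) n) + L)))} with hG
  let E : ℝ → ℝ → Set Ω := fun l a => {ω | ∃ n, a ≤ l * ∑ i ∈ range (n + 1), X i ω -
        2 * l ^ 2 * ∑ i ∈ range (n + 1), X i ω ^ 2}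
  let l : ℕ → ℝ := fun j => 1 / (8 * 2 ^ j)
  let a : ℕ → ℝ := fun j => L + Real.log (2 * (((j : ℝ) + 1) * (j + 2)))
  have hl0 : ∀ j, 0 < l j := fun j => by positivity
  have hl : ∀ j, l j ≤ 1 / 4 := fun j => by
    apply div_le_div_of_nonneg_left (by norm_num) (by norm_num)
    nlinarith [one_le_pow₀ (one_le_two : (1 : ℝ) ≤ 2) (n := j)]
  have hexp : ∀ j, Real.exp (-a j) = δ / 2 * (1 / (((j : ℝ) + 1) * (j + 2))) := fun j => by
    have hpos : (0 : ℝ) < 2 * (((j : ℝ) + 1) * (j + 2)) := by positivity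
    simp only [a]
    rw [Real.exp_neg, Real.exp_add, Real.exp_log hpos, hLdef, Real.exp_log (by positivity)]
    field_simp
  have hbad : Gᶜ ≤ᵐ[μ] ⋃ j, (E (l j) (a j) ∪ E (-l j) (a j)) := by
    filter_upwards [ae_all_iff.2 hbi] with ω hω
    intro hωG
    by_contra hnot
    refine hωG fun n hn => ?_
    -- L > 0 excludes n = 0.
    obtain ⟨m, rfl⟩ : ∃ m, n = m + 1 := Nat.exists_eq_succ_of_ne_zero fun h => by
      subst h; simp at hn; linarith
    refine abs_sum_le_of_forall_slope (fun i => abs_le.2 (hω i)) hL.le m fun j => ?_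
    have hnot' : ω ∉ ⋃ j, (E (l j) (a j) ∪ E (-l j) (a j)) := hnot
    simp only [Set.mem_iUnion, Set.mem_union, not_exists, not_or] at hnot'
    obtain ⟨hp, hq⟩ := hnot' j
    have hp' := not_le.1 fun h => hp ⟨m, h⟩
    have hq' := not_le.1 fun h => hq ⟨m, h⟩
    rw [neg_sq] at hq'
    rcases abs_cases (∑ i ∈ range (m + 1), X i ω) with ⟨h, _⟩ | ⟨h, _⟩
    · rw [h]; exact hp'.le
    · rw [h, mul_neg, ← neg_mul]; exact hq'.le
  have hE : ∀ j, μ (E (l j) (a j) ∪ E (-l j) (a j)) ≤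
      ENNReal.ofReal (δ * (1 / (((j : ℝ) + 1) * (j + 2)))) := fun j => by
    have h1 := measure_exists_le_mul_sum_sub_le hX hm hbi h0i (l := l j)
      (by rw [abs_of_pos (hl0 j)]; exact hl j) (a j)
    have h2 := measure_exists_le_mul_sum_sub_le hX hm hbi h0i (l := -l j)
      (by rw [abs_neg, abs_of_pos (hl0 j)]; exact hl j) (a j)
    refine (measure_union_le _ _).trans ((add_le_add h1 h2).trans_eq ?_)
    rw [← ENNReal.ofReal_add (Real.exp_pos _).le (Real.exp_pos _).le, hexp]
    congr 1
    ring
  have hsum := hasSum_one_div_succ_mul_succ_succ.mul_left δ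
  have hGc : μ Gᶜ ≤ ENNReal.ofReal δ := by
    calc μ Gᶜ ≤ μ (⋃ j, (E (l j) (a j) ∪ E (-l j) (a j))) := measure_mono_ae hbad
      _ ≤ ∑' j, μ (E (l j) (a j) ∪ E (-l j) (a j)) := measure_iUnion_le _
      _ ≤ ∑' j : ℕ, ENNReal.ofReal (δ * (1 / (((j : ℝ) + 1) * (j + 2)))) :=
        ENNReal.tsum_le_tsum hE
      _ = ENNReal.ofReal δ := by
        rw [← ENNReal.ofReal_tsum_of_nonneg (fun j => by positivity) hsum.summable,
          hsum.tsum_eq, mul_one]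
  have hGc' : μ.real Gᶜ ≤ δ := ENNReal.toReal_le_of_le_ofReal hδ.le hGc
  have huniv : 1 ≤ μ.real G + μ.real Gᶜ := by
    have h := measureReal_union_le (μ := μ) G Gᶜ
    rwa [Set.union_compl_self, probReal_univ] at h
  linarith
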